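/- **Proposition.** Let $(\mathcal X,\mathbb P_x)$ be a probability space, let $f_y:\mathcal X\to\mathcal Y$ be a measurable labelling function, let $\mathcal Z$ be a latent space with a metric $d_z$ whose open sets are measurable, let $\mathcal V$ be a measurable space of predictions (for instance $\mathcal V=\mathcal Y$), and let $\ell:\mathcal V\times\mathcal Y\to[0,\infty]$ be a measurable loss. Fix a codebook size $M$. For a codebook $C=(c_1,\dots,c_M)\in\mathcal Z^M$ and weights $\pi$ in the simplex $\Delta_M$, put $\mathbb P_{c,\pi}=\sum_{m=1}^M\pi_m\delta_{c_m}$. For probability measures $\mu$ on $\mathcal V$ and $\nu$ on $\mathcal Y$, let $\mathcal W_\ell(\mu,\nu)=\inf_{\gamma\in\Gamma(\mu,\nu)}\int \ell\,d\gamma$, where $\Gamma(\mu,\nu)$ is the set of couplings of $\mu$ and $\nu$. A *stochastic discrete encoder* is a Markov kernel $\bar f_e$ from $\mathcal X$ to $\mathcal Z$ with $\bar f_e(x)$ concentrated on $\{c_1,\dots,c_M\}$ for every $x$; $\bar f_e\#\mathbb P_x$ is the law of $c$ when $x\sim\mathbb P_x$, $c\sim\bar f_e(x)$. A *deterministic discrete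 encoder* is a measurable map $\bar f_e:\mathcal X\to\mathcal Z$ with values in $\{c_1,\dots,c_M\}$. (1) For every codebook $C$, weights $\pi\in\Delta_M$ and measurable decoder $f_d:\mathcal Z\to\mathcal V$, the following minimum over stochastic discrete encoders is attained, and $$\min_{\bar f_e:\ \bar f_e\#\mathbb P_x=\mathbb P_{c,\pi}}\mathbb E_{x\sim\mathbb P_x,\,c\sim\bar f_e(x)}\big[\ell(f_d(c),f_y(x))\big]=\mathcal W_\ell\big(f_d\#\mathbb P_{c,\pi},\,f_y\#\mathbb P_x\big).$$ (2) Let $C$ range over any given class of codebooks in $\mathcal Z^M$, $\pi$ over $\Delta_M$, and $f_d$ over any given class of measurable decoders (in particular: over all codebooks and all measurable decoders). The following four optimization problems over $(C,\pi,f_d)$ and, where present, an encoder have the same infimum in $[0,\infty]$ (with $\inf\emptyset=\infty$), and if one of them attains its minimum then all do: - minimize $\mathcal W_\ell(f_d\#\mathbb P_{c,\pi},f_y\#\mathbb P_x)$; - minimize $\mathbb E_{x\sim\mathbb P_x,\,c\sim\bar f_e(x)}[\ell(f_d(c),f_y(x))]$ over stochastic discrete encoders with $\bar f_e\#\mathbb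 P_x=\mathbb P_{c,\pi}$; - minimize $\mathbb E_{x\sim\mathbb P_x}[\ell(f_d(\bar f_e(x)),f_y(x))]$ over deterministic discrete encoders with $\bar f_e\#\mathbb P_x=\mathbb P_{c,\pi}$; - minimize the same objective over encoders $\bar f_e=Q_C\circ f_e$ with $\bar f_e\#\mathbb P_x=\mathbb P_{c,\pi}$, where $f_e:\mathcal X\to\mathcal Z$ is measurable and $Q_C:\mathcal Z\to\mathcal Z$ is a measurable map sending each $z$ to a codeword at minimal $d_z$-distance from $z$. -/

import Mathlib

open MeasureTheory ProbabilityTheory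
open scoped ENNReal

noncomputable section

/-- The discrete distribution `∑ m, π m • δ_{C m}` on the latent space, for the codebook `C`
with category probabilities `π`. -/
def codeMeasure {Z : Type*} [MeasurableSpace Z] {M : ℕ} (C : Fin M → Z) (π : Fin M → ℝ) :
    Measure Z :=
  ∑ m, ENNReal.ofReal (π m) • Measure.dirac (C m)

/-- A coupling of `μ` and `ν`: a measure on the product with marginals `μ` and `ν`. -/
structure IsCoupling {V Y : Type*} [MeasurableSpace V] [MeasurableSpace Y]
    (μ : Measure V) (ν : Measure Y) (γ : Measure (V × Y)) : Prop where
  map_fst : γ.map Prod.fst = μ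
  map_snd : γ.map Prod.snd = ν

/-- The optimal-transport (Wasserstein) cost `W_ℓ(μ, ν)`, the infimum of `∫ ℓ dγ` over all
couplings `γ` of `μ` and `ν`. -/
def transportCost {V Y : Type*} [MeasurableSpace V] [MeasurableSpace Y]
    (ℓ : V → Y → ℝ≥0∞) (μ : Measure V) (ν : Measure Y) : ℝ≥0∞ :=
  ⨅ (γ : Measure (V × Y)) (_ : IsCoupling μ ν γ), ∫⁻ p, ℓ p.1 p.2 ∂γ

/-- A stochastic discrete encoder: a Markov kernel from data to codewords whose pushforward of
the data distribution `P` is `codeMeasure C π`. -/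
structure IsStochasticEncoder {X Z : Type*} [MeasurableSpace X] [MeasurableSpace Z] {M : ℕ}
    (P : Measure X) (C : Fin M → Z) (π : Fin M → ℝ) (κ : Kernel X Z) : Prop where
  isMarkov : IsMarkovKernel κ
  codeword : ∀ x, κ x (Set.range C)ᶜ = 0
  push : P.bind κ = codeMeasure C π

/-- A deterministic discrete encoder: a measurable map from data to codewords whose pushforward
of the data distribution `P` is `codeMeasure C π`. -/
structure IsDeterministicEncoder {X Z : Type*} [MeasurableSpace X] [MeasurableSpace Z] {M : ℕ}
    (P : Measure X) (C : Fin M → Z) (π : Fin M → ℝ) (f : X → Z) : Prop where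
  measurable : Measurable f
  codeword : ∀ x, f x ∈ Set.range C
  push : P.map f = codeMeasure C π

/-- A quantization operator for the codebook `C`: a measurable map sending each latent point to
a nearest codeword. -/
structure IsQuantizer {Z : Type*} [MetricSpace Z] [MeasurableSpace Z] {M : ℕ}
    (C : Fin M → Z) (Q : Z → Z) : Prop where
  measurable : Measurable Q
  codeword : ∀ z, Q z ∈ Set.range C
  nearest : ∀ z m, dist z (Q z) ≤ dist z (C m)

/-- The expected losses `E_{x ∼ P, c ∼ κ x} ℓ(fd c, fy x)` of all stochastic discrete encoders
`κ`, for a fixed codebook `C`, weights `π` and decoder `fd`. -/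
def stochasticCosts {X Z V Y : Type*} [MeasurableSpace X] [MeasurableSpace Z] {M : ℕ}
    (P : Measure X) (fy : X → Y) (ℓ : V → Y → ℝ≥0∞)
    (C : Fin M → Z) (π : Fin M → ℝ) (fd : Z → V) : Set ℝ≥0∞ :=
  {v | ∃ κ : Kernel X Z, IsStochasticEncoder P C π κ ∧
    v = ∫⁻ x, ∫⁻ c, ℓ (fd c) (fy x) ∂(κ x) ∂P}

/-- The expected losses `E_{x ∼ P} ℓ(fd (f x), fy x)` of all deterministic discrete encoders
`f`, for a fixed codebook `C`, weights `π` and decoder `fd`. -/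
def deterministicCosts {X Z V Y : Type*} [MeasurableSpace X] [MeasurableSpace Z] {M : ℕ}
    (P : Measure X) (fy : X → Y) (ℓ : V → Y → ℝ≥0∞)
    (C : Fin M → Z) (π : Fin M → ℝ) (fd : Z → V) : Set ℝ≥0∞ :=
  {v | ∃ f : X → Z, IsDeterministicEncoder P C π f ∧ v = ∫⁻ x, ℓ (fd (f x)) (fy x) ∂P}

/-- The expected losses `E_{x ∼ P} ℓ(fd (Q (fe x)), fy x)` of all encoders of the form `Q ∘ fe`,
with `fe` a measurable map to the latent space and `Q` a quantization operator, that push `P`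
forward to `codeMeasure C π`. -/
def quantizedCosts {X Z V Y : Type*} [MeasurableSpace X] [MetricSpace Z] [MeasurableSpace Z]
    {M : ℕ} (P : Measure X) (fy : X → Y) (ℓ : V → Y → ℝ≥0∞)
    (C : Fin M → Z) (π : Fin M → ℝ) (fd : Z → V) : Set ℝ≥0∞ :=
  {v | ∃ (fe : X → Z) (Q : Z → Z), Measurable fe ∧ IsQuantizer C Q ∧
    P.map (Q ∘ fe) = codeMeasure C π ∧ v = ∫⁻ x, ℓ (fd (Q (fe x))) (fy x) ∂P}

/-- All values of the objective `K` as the codebook ranges over `𝓒`, the weights over the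
simplex and the decoder over `𝓓`. -/
def totalCosts {Z V : Type*} {M : ℕ} (𝓒 : Set (Fin M → Z)) (𝓓 : Set (Z → V))
    (K : (Fin M → Z) → (Fin M → ℝ) → (Z → V) → Set ℝ≥0∞) : Set ℝ≥0∞ :=
  {v | ∃ C ∈ 𝓒, ∃ π ∈ stdSimplex ℝ (Fin M), ∃ fd ∈ 𝓓, v ∈ K C π fd}

/-- Two minimization problems, given by their sets of objective values, have the same optimum:
the infima agree, and a value is a minimum of one iff it is a minimum of the other. -/
def SameOptimum (A B : Set ℝ≥0∞) : Prop :=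
  sInf A = sInf B ∧ ∀ v, IsLeast A v ↔ IsLeast B v

end

/-!
For a fixed codebook `C`, decoder `fd` and weights `π`, a stochastic encoder couples the data law
with the law of the codewords, and pushing this coupling forward by the labelling and the decoder
gives a coupling of the two laws in the transport cost. So the transport cost is a lower bound for
the expected loss (`transportCost_le_of_mem_stochasticCosts`).

For equality, with the minimum attained although the loss is merely measurable, the label `y` is
replaced by its profile `m ↦ ℓ (fd (C m)) y` in the compact metrizable space `Fin M → [0, ∞]`. The
loss of the pair `(m, t)` of an index and a profile is `t m`, which is continuous. Weak compactness
of the set of couplings gives an optimal one (`exists_optimal_coupling`), and disintegrating it over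
the profile gives an encoder. No coupling in the transport problem does better, since each lifts to
a coupling of the index law with the label law (`exists_coupling_lift`). Every conditional law used
lives on the finite set of indices, so the prediction and label spaces need no regularity.

When the weights vary as well, the encoder sending each point to a codeword of smallest loss
is measurable and beats every stochastic encoder. Its own law supplies the weights, and it has
the form `Q ∘ fe` because a quantization operator fixes every codeword
(`exists_quantizedCosts_le`). Since quantized encoders are deterministic and deterministic ones are
stochastic, these problems have the same optimum.
-/

open Set Filter Topology

/-! ### Finite argmins and the discrete law -/

/-- Among finitely many measurable functions, the index of a smallest one can be chosen
measurably. -/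
lemma exists_measurable_argmin {X α : Type*} [MeasurableSpace X] [LinearOrder α]
    [TopologicalSpace α] [OrderClosedTopology α] [SecondCountableTopology α] [MeasurableSpace α]
    [OpensMeasurableSpace α] {M : ℕ} [NeZero M] {f : Fin M → X → α} (hf : ∀ m, Measurable (f m)) :
    ∃ j : X → Fin M, Measurable j ∧ ∀ x m, f (j x) x ≤ f m x := by
  -- The smallest minimizing index is determined by finitely many measurable comparisons.
  have hex : ∀ x, ∃ i, (∀ m, f i x ≤ f m x) ∧ ∀ k < i, ¬ ∀ m, f k x ≤ f m x := by
    intro x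
    obtain ⟨i₀, hi₀⟩ := Finite.exists_min fun m ↦ f m x
    have hne : {i | ∀ m, f i x ≤ f m x}.Nonempty := ⟨i₀, hi₀⟩
    exact ⟨wellFounded_lt.min _ hne, wellFounded_lt.min_mem _ hne,
      fun k hk h ↦ wellFounded_lt.not_lt_min {i | ∀ m, f i x ≤ f m x} h hk⟩
  choose j hj hmin using hex
  refine ⟨j, measurable_to_countable' fun i ↦ ?_, hj⟩
  have hset : j ⁻¹' {i} =
      {x | (∀ m, f i x ≤ f m x) ∧ ∀ k, k < i → ¬ ∀ m, f k x ≤ f m x} := by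
    ext x
    refine ⟨?_, fun ⟨h₁, h₂⟩ ↦ ?_⟩
    · rintro rfl
      exact ⟨hj x, hmin x⟩
    · refine le_antisymm (not_lt.1 fun h ↦ hmin x i h h₁) (not_lt.1 fun h ↦ h₂ _ h (hj x))
  have hP : ∀ k, MeasurableSet {x | ∀ m, f k x ≤ f m x} := fun k ↦ by
    simp only [ofPred_forall]
    exact MeasurableSet.iInter fun m ↦ measurableSet_le (hf k) (hf m)
  rw [hset, ofPred_and]
  simp only [ofPred_forall (p := fun k x ↦ k < i → ¬ ∀ m, f k x ≤ f m x),
    ofPred_forall (p := fun (_ : _ < i) x ↦ ¬ ∀ m, f _ x ≤ f m x)]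
  exact (hP i).inter (MeasurableSet.iInter fun k ↦ MeasurableSet.iInter fun _ ↦ (hP k).compl)

/-- The law on codewords is the image of the law on indices. -/
lemma map_codeMeasure {Z W : Type*} [MeasurableSpace Z] [MeasurableSpace W] {M : ℕ}
    (C : Fin M → Z) (π : Fin M → ℝ) {f : Z → W} (hf : Measurable f) :
    (codeMeasure C π).map f = codeMeasure (f ∘ C) π := by
  simp only [codeMeasure, ← Measure.mapₗ_apply_of_measurable hf, map_sum, map_smul]
  simp only [Measure.mapₗ_apply_of_measurable hf, Measure.map_dirac' hf, Function.comp_apply]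

lemma isProbabilityMeasure_codeMeasure {Z : Type*} [MeasurableSpace Z] {M : ℕ}
    (C : Fin M → Z) {π : Fin M → ℝ} (hπ : π ∈ stdSimplex ℝ (Fin M)) :
    IsProbabilityMeasure (codeMeasure C π) := by
  constructor
  simp only [codeMeasure, Measure.coe_finsetSum, Finset.sum_apply, Measure.smul_apply,
    measure_univ, smul_eq_mul, mul_one]
  rw [← ENNReal.ofReal_sum_of_nonneg fun i _ ↦ hπ.1 i, hπ.2, ENNReal.ofReal_one]

/-- Every probability measure on indices comes from weights in the simplex. -/
lemma exists_codeMeasure_id_eq {M : ℕ} (μ : Measure (Fin M)) [IsProbabilityMeasure μ] :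
    ∃ π ∈ stdSimplex ℝ (Fin M), codeMeasure id π = μ := by
  refine ⟨fun m ↦ μ.real {m}, ⟨fun m ↦ measureReal_nonneg, ?_⟩, ?_⟩
  · simp
  · rw [codeMeasure]
    simp only [ofReal_measureReal (measure_ne_top _ _), id]
    rw [← Measure.sum_fintype, Measure.sum_smul_dirac]

lemma neZero_of_mem_stdSimplex {M : ℕ} {π : Fin M → ℝ} (hπ : π ∈ stdSimplex ℝ (Fin M)) :
    NeZero M :=
  ⟨by rintro rfl; simpa using hπ.2⟩

/-! ### Optimal couplings on compact spaces -/

/-- The integral of a continuous `[0, ∞]`-valued function is lower semicontinuous for weak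
convergence: truncated at level `n` it is continuous, and the truncations increase to it. -/
lemma lowerSemicontinuous_lintegral_of_continuous {E : Type*} [TopologicalSpace E]
    [MeasurableSpace E] [OpensMeasurableSpace E] {c : E → ℝ≥0∞} (hc : Continuous c) :
    LowerSemicontinuous fun γ : ProbabilityMeasure E ↦ ∫⁻ p, c p ∂(γ : Measure E) := by
  have htop : ∀ (n : ℕ) p, min (c p) n ≠ ∞ := fun n p ↦
    ne_top_of_le_ne_top (ENNReal.natCast_ne_top n) (min_le_right _ _)
  have hcont : ∀ n : ℕ, Continuous fun p ↦ (min (c p) n).toNNReal := fun n ↦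
    ENNReal.continuousOn_toNNReal.comp_continuous (hc.min continuous_const) (htop n)
  have hsup : ∀ p, c p = ⨆ n : ℕ, min (c p) n := fun p ↦ by
    rw [← inf_iSup_eq, ENNReal.iSup_natCast, inf_top_eq]
  have hlim : ∀ γ : ProbabilityMeasure E, ∫⁻ p, c p ∂(γ : Measure E) =
      ⨆ n : ℕ, ∫⁻ p, ((min (c p) n).toNNReal : ℝ≥0∞) ∂(γ : Measure E) := fun γ ↦ by
    simp_rw [ENNReal.coe_toNNReal (htop _ _)]
    rw [← lintegral_iSup]
    · exact lintegral_congr hsup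
    · exact fun n ↦ (hc.min continuous_const).measurable
    · exact fun i k h p ↦ min_le_min_left _ (Nat.cast_le.2 h)
  simp_rw [hlim]
  refine lowerSemicontinuous_iSup fun n ↦ Continuous.lowerSemicontinuous ?_
  refine ProbabilityMeasure.continuous_lintegral_boundedContinuousFunction
    (BoundedContinuousFunction.mkOfBound ⟨_, hcont n⟩ n fun p q ↦ ?_)
  have hle : ∀ r, (min (c r) n).toNNReal ≤ n := fun r ↦
    by
    rw [← ENNReal.coe_le_coe, ENNReal.coe_toNNReal (htop n r)]
    exact min_le_right _ _
  rw [NNReal.dist_eq, abs_le]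
  have hp : ((min (c p) n).toNNReal : ℝ) ≤ n := by exact_mod_cast hle p
  have hq : ((min (c q) n).toNNReal : ℝ) ≤ n := by exact_mod_cast hle q
  have hp₀ := (min (c p) n).toNNReal.coe_nonneg
  have hq₀ := (min (c q) n).toNNReal.coe_nonneg
  constructor <;> simp only [ContinuousMap.coe_mk] <;> linarith

lemma IsCoupling.isProbabilityMeasure {V Y : Type*} [MeasurableSpace V] [MeasurableSpace Y]
    {μ : Measure V} [IsProbabilityMeasure μ] {ν : Measure Y} {γ : Measure (V × Y)}
    (hγ : IsCoupling μ ν γ) : IsProbabilityMeasure γ := ⟨by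
  rw [← preimage_univ (f := Prod.fst), ← Measure.map_apply measurable_fst .univ, hγ.map_fst,
    measure_univ]⟩

/-- On compact metrizable spaces a continuous cost has an optimal coupling: the couplings form a
compact set of probability measures, on which the cost is lower semicontinuous. -/
lemma exists_optimal_coupling {K L : Type*} [TopologicalSpace K] [CompactSpace K]
    [TopologicalSpace.MetrizableSpace K] [SecondCountableTopology K] [MeasurableSpace K]
    [BorelSpace K] [TopologicalSpace L] [CompactSpace L] [TopologicalSpace.MetrizableSpace L]
    [SecondCountableTopology L] [MeasurableSpace L] [BorelSpace L]
    (μ : Measure K) (ν : Measure L) [IsProbabilityMeasure μ] [IsProbabilityMeasure ν]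
    {c : K × L → ℝ≥0∞} (hc : Continuous c) :
    ∃ γ, IsCoupling μ ν γ ∧ ∀ γ', IsCoupling μ ν γ' → ∫⁻ p, c p ∂γ ≤ ∫⁻ p, c p ∂γ' := by
  let S : Set (ProbabilityMeasure (K × L)) := {γ | IsCoupling μ ν (γ : Measure (K × L))}
  have hS : S =
      (fun γ : ProbabilityMeasure (K × L) ↦ γ.map continuous_fst.aemeasurable) ⁻¹'
        {(⟨μ, inferInstance⟩ : ProbabilityMeasure K)} ∩
      (fun γ : ProbabilityMeasure (K × L) ↦ γ.map continuous_snd.aemeasurable) ⁻¹'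
        {(⟨ν, inferInstance⟩ : ProbabilityMeasure L)} := by
    ext γ
    simp only [S, mem_ofPred_eq, mem_inter_iff, mem_preimage]
    refine ⟨fun h ↦ ⟨Subtype.ext h.map_fst, Subtype.ext h.map_snd⟩, fun h ↦
      ⟨congrArg Subtype.val h.1, congrArg Subtype.val h.2⟩⟩
  have hclosed : IsClosed S := by
    rw [hS]
    exact (isClosed_singleton.preimage (ProbabilityMeasure.continuous_map continuous_fst)).inter
      (isClosed_singleton.preimage (ProbabilityMeasure.continuous_map continuous_snd))
  have hne : S.Nonempty := ⟨⟨μ.prod ν, inferInstance⟩, by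
    constructor
    · simp [Measure.map_fst_prod]
    · simp [Measure.map_snd_prod]⟩
  obtain ⟨γ, hγS, hγ⟩ := (lowerSemicontinuous_lintegral_of_continuous hc).lowerSemicontinuousOn S
    |>.exists_isMinOn hne hclosed.isCompact
  refine ⟨γ, hγS, fun γ' hγ' ↦ ?_⟩
  have : IsProbabilityMeasure γ' := hγ'.isProbabilityMeasure
  exact hγ (a := ⟨γ', this⟩) hγ'

/-! ### Couplings with a discrete law on an arbitrary measurable space -/

/-- A measure on a product is unchanged when one coordinate is replaced by another that lies almost
surely in the same measurable sets. Points of `V` need not be separated by measurable sets, so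
the two coordinates need not be almost surely equal. -/
lemma map_prodMk_eq_of_forall_ae_mem_iff {Ω V Y : Type*} [MeasurableSpace Ω]
    [MeasurableSpace V] [MeasurableSpace Y] {μ : Measure Ω} [IsFiniteMeasure μ] {f g : Ω → V}
    {h : Ω → Y} (hf : Measurable f) (hg : Measurable g) (hh : Measurable h)
    (hfg : ∀ B, MeasurableSet B → ∀ᵐ ω ∂μ, f ω ∈ B ↔ g ω ∈ B) :
    μ.map (fun ω ↦ (f ω, h ω)) = μ.map (fun ω ↦ (g ω, h ω)) := by
  refine Measure.ext_prod fun {B S} hB hS ↦ ?_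
  rw [Measure.map_apply (hf.prodMk hh) (hB.prod hS), Measure.map_apply (hg.prodMk hh) (hB.prod hS)]
  refine measure_congr ?_
  filter_upwards [hfg B hB] with ω hω
  exact propext (and_congr_left' hω)

/-- A coupling whose first marginal is the image of a law `p` on indices lifts to a coupling of `p`
itself, with the same joint law on `V × Y`. The lift glues the coupling to the conditional law of
the index given its image. -/
lemma exists_coupling_lift {V Y : Type*} [MeasurableSpace V] [MeasurableSpace Y] {M : ℕ} [NeZero M]
    {p : Measure (Fin M)} [IsProbabilityMeasure p] {ν : Measure Y} {v : Fin M → V}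
    {γ : Measure (V × Y)} (hγ : IsCoupling (p.map v) ν γ) :
    ∃ ρ, IsCoupling p ν ρ ∧ ρ.map (Prod.map v id) = γ := by
  have hv : Measurable v := measurable_of_finite v
  let θ : Measure (V × Fin M) := p.map fun m ↦ (v m, m)
  have hvm : Measurable fun m ↦ (v m, m) := hv.prodMk measurable_id
  have : IsProbabilityMeasure θ := Measure.isProbabilityMeasure_map hvm.aemeasurable
  have : IsProbabilityMeasure (p.map v) := Measure.isProbabilityMeasure_map hv.aemeasurable
  have : IsProbabilityMeasure γ := hγ.isProbabilityMeasure
  have hθfst : θ.fst = p.map v := by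
    rw [Measure.fst, Measure.map_map measurable_fst hvm]
    rfl
  let G : Measure ((V × Y) × Fin M) := γ ⊗ₘ θ.condKernel.comap Prod.fst measurable_fst
  have hGfst : G.map Prod.fst = γ := Measure.fst_compProd _ _
  have hGθ : G.map (fun q ↦ (q.1.1, q.2)) = θ := by
    have hq : Measurable fun q : (V × Y) × Fin M ↦ (q.1.1, q.2) := by fun_prop
    refine Measure.ext_of_lintegral _ fun F hF ↦ ?_
    have hG : ∫⁻ q, F (q.1.1, q.2) ∂G = ∫⁻ r, ∫⁻ m, F (r.1, m) ∂θ.condKernel r.1 ∂γ :=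
      Measure.lintegral_compProd (f := fun q : (V × Y) × Fin M ↦ F (q.1.1, q.2)) (hF.comp hq)
    rw [lintegral_map hF hq, hG]
    conv_rhs => rw [← θ.disintegrate θ.condKernel]
    rw [Measure.lintegral_compProd hF, hθfst, ← hγ.map_fst,
      lintegral_map hF.lintegral_kernel_prod_right' measurable_fst]
  have hm : Measurable fun q : (V × Y) × Fin M ↦ (q.2, q.1.2) := by fun_prop
  refine ⟨G.map fun q ↦ (q.2, q.1.2), ⟨?_, ?_⟩, ?_⟩
  · rw [Measure.map_map measurable_fst hm]
    calc G.map (Prod.snd ∘ fun q ↦ (q.1.1, q.2)) = θ.map Prod.snd := by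
          rw [← hGθ, Measure.map_map measurable_snd (by fun_prop)]
      _ = p := by
          rw [Measure.map_map measurable_snd hvm]
          exact Measure.map_id
  · rw [Measure.map_map measurable_snd hm]
    calc G.map (Prod.snd ∘ Prod.fst) = γ.map Prod.snd := by
          rw [← hGfst, Measure.map_map measurable_snd measurable_fst]
      _ = ν := hγ.map_snd
  · rw [Measure.map_map (hv.prodMap measurable_id) hm]
    refine (map_prodMk_eq_of_forall_ae_mem_iff (μ := G) (f := fun q ↦ v q.2)
      (g := fun q ↦ q.1.1) (h := fun q ↦ q.1.2) (by fun_prop) (by fun_prop) (by fun_prop)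
      fun B hB ↦ ?_).trans hGfst
    -- Under `θ` the first coordinate is the image of the second. The graph of `v` need not be
    -- measurable, so this is tested one measurable set `B` at a time.
    have hset : MeasurableSet {q : V × Fin M | v q.2 ∈ B ↔ q.1 ∈ B} :=
      (hB.preimage (hv.comp measurable_snd)).iff (hB.preimage measurable_fst)
    have : ∀ᵐ q ∂θ, v q.2 ∈ B ↔ q.1 ∈ B := by
      rw [ae_map_iff hvm.aemeasurable hset]
      simp
    rw [← hGθ] at this
    exact ae_of_ae_map (by fun_prop) this

/-! ### Stochastic encoders and transport cost -/

/-- The joint law of the decoded codeword and the label under a stochastic encoder is a coupling, so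
the transport cost is a lower bound for the expected loss. -/
lemma transportCost_le_of_mem_stochasticCosts {X Z V Y : Type*} [MeasurableSpace X]
    [MeasurableSpace Z] [MeasurableSpace V] [MeasurableSpace Y] {M : ℕ} {P : Measure X}
    [IsProbabilityMeasure P] {fy : X → Y} (hfy : Measurable fy) {ℓ : V → Y → ℝ≥0∞}
    (hℓ : Measurable (Function.uncurry ℓ)) {C : Fin M → Z} {π : Fin M → ℝ} {fd : Z → V}
    (hfd : Measurable fd) {a : ℝ≥0∞} (ha : a ∈ stochasticCosts P fy ℓ C π fd) :
    transportCost ℓ ((codeMeasure C π).map fd) (P.map fy) ≤ a := by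
  obtain ⟨κ, hκ, rfl⟩ := ha
  have := hκ.isMarkov
  have hm : Measurable fun q : X × Z ↦ (fd q.2, fy q.1) := by fun_prop
  have hγ : IsCoupling ((codeMeasure C π).map fd) (P.map fy)
      ((P ⊗ₘ κ).map fun q ↦ (fd q.2, fy q.1)) := by
    constructor
    · rw [Measure.map_map measurable_fst hm, ← hκ.push, ← Measure.snd_compProd, Measure.snd,
        Measure.map_map hfd measurable_snd]
      rfl
    · rw [Measure.map_map measurable_snd hm]
      conv_rhs => rw [← Measure.fst_compProd P κ, Measure.fst, Measure.map_map hfy measurable_fst]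
      rfl
  refine (iInf₂_le _ hγ).trans_eq ?_
  rw [lintegral_map (f := fun p : V × Y ↦ ℓ p.1 p.2) hℓ hm,
    Measure.lintegral_compProd (f := fun q : X × Z ↦ ℓ (fd q.2) (fy q.1)) (hℓ.comp hm)]

/-- Some stochastic encoder attains the transport cost. The loss depends on a label `y` only through
its profile `m ↦ ℓ (fd (C m)) y`, a point of the compact space `Fin M → [0, ∞]`. An optimal
coupling of indices and profiles, disintegrated over the profiles, gives the encoder. -/
lemma exists_stochasticCosts_le_transportCost {X Z V Y : Type*} [MeasurableSpace X]
    [MeasurableSpace Z] [MeasurableSingletonClass Z] [MeasurableSpace V] [MeasurableSpace Y]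
    {M : ℕ} {P : Measure X} [IsProbabilityMeasure P] {fy : X → Y} (hfy : Measurable fy)
    {ℓ : V → Y → ℝ≥0∞} (hℓ : Measurable (Function.uncurry ℓ)) (C : Fin M → Z) {π : Fin M → ℝ}
    (hπ : π ∈ stdSimplex ℝ (Fin M)) {fd : Z → V} (hfd : Measurable fd) :
    ∃ a ∈ stochasticCosts P fy ℓ C π fd,
      a ≤ transportCost ℓ ((codeMeasure C π).map fd) (P.map fy) := by
  have := neZero_of_mem_stdSimplex hπ
  have hC : Measurable C := measurable_of_finite C
  let p : Measure (Fin M) := codeMeasure id π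
  have : IsProbabilityMeasure p := isProbabilityMeasure_codeMeasure _ hπ
  have hpC : p.map C = codeMeasure C π := map_codeMeasure id π hC
  let T : Y → Fin M → ℝ≥0∞ := fun y m ↦ ℓ (fd (C m)) y
  have hT : Measurable T :=
    measurable_pi_lambda _ fun m ↦ hℓ.comp (measurable_const.prodMk measurable_id)
  have hTfy : Measurable (T ∘ fy) := hT.comp hfy
  let c : Fin M × (Fin M → ℝ≥0∞) → ℝ≥0∞ := fun q ↦ q.2 q.1
  have hc : Continuous c := continuous_prod_of_discrete_left.2 fun m ↦ continuous_apply m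
  have : IsProbabilityMeasure (P.map (T ∘ fy)) :=
    Measure.isProbabilityMeasure_map hTfy.aemeasurable
  obtain ⟨γ, hγ, hopt⟩ := exists_optimal_coupling p (P.map (T ∘ fy)) hc
  let γs : Measure ((Fin M → ℝ≥0∞) × Fin M) := γ.map Prod.swap
  have : IsProbabilityMeasure γ := hγ.isProbabilityMeasure
  have : IsProbabilityMeasure γs := Measure.isProbabilityMeasure_map (by fun_prop)
  have hγs : (P.map (T ∘ fy)) ⊗ₘ γs.condKernel = γs := by
    conv_rhs => rw [← γs.disintegrate γs.condKernel]
    rw [← hγ.map_snd, Measure.fst, Measure.map_map measurable_fst measurable_swap]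
    rfl
  let κ : Kernel X Z := (γs.condKernel.comap (T ∘ fy) hTfy).map C
  have hκ : ∀ x, κ x = (γs.condKernel (T (fy x))).map C := fun x ↦ by
    rw [Kernel.map_apply _ hC, Kernel.comap_apply]
    rfl
  have hκM : IsMarkovKernel κ := Kernel.IsMarkovKernel.map _ hC
  refine ⟨_, ⟨κ, ⟨hκM, fun x ↦ ?_, ?_⟩, rfl⟩, ?_⟩
  · rw [hκ, Measure.map_apply hC (finite_range C).measurableSet.compl]
    simp
  · rw [← hpC, ← hγ.map_fst]
    refine Measure.ext_of_lintegral _ fun F hF ↦ ?_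
    rw [Measure.lintegral_bind κ.measurable.aemeasurable hF.aemeasurable,
      lintegral_map hF hC,
      lintegral_map (f := fun m ↦ F (C m)) (hF.comp hC) measurable_fst]
    calc ∫⁻ x, ∫⁻ z, F z ∂κ x ∂P
        = ∫⁻ x, ∫⁻ m, F (C m) ∂(γs.condKernel ((T ∘ fy) x)) ∂P := by
          simp_rw [hκ, lintegral_map hF hC]
          rfl
      _ = ∫⁻ t, ∫⁻ m, F (C m) ∂(γs.condKernel t) ∂(P.map (T ∘ fy)) :=
          (lintegral_map (Measurable.lintegral_kernel (hF.comp hC)) hTfy).symm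
      _ = ∫⁻ q, F (C q.2) ∂γs := by
          conv_rhs => rw [← hγs]
          exact (Measure.lintegral_compProd (hF.comp (hC.comp measurable_snd))).symm
      _ = ∫⁻ q, F (C q.1) ∂γ :=
          lintegral_map (hF.comp (hC.comp measurable_snd)) measurable_swap
  · have hcost : ∫⁻ x, ∫⁻ z, ℓ (fd z) (fy x) ∂κ x ∂P = ∫⁻ q, c q ∂γ := by
      have hcs : Measurable fun q : (Fin M → ℝ≥0∞) × Fin M ↦ c q.swap :=
        hc.measurable.comp measurable_swap
      calc ∫⁻ x, ∫⁻ z, ℓ (fd z) (fy x) ∂κ x ∂P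
          = ∫⁻ x, ∫⁻ m, c (m, (T ∘ fy) x) ∂(γs.condKernel ((T ∘ fy) x)) ∂P := by
            refine lintegral_congr fun x ↦ ?_
            rw [hκ, lintegral_map (f := fun z ↦ ℓ (fd z) (fy x))
              (hℓ.comp (hfd.prodMk measurable_const)) hC]
            rfl
        _ = ∫⁻ t, ∫⁻ m, c (m, t) ∂(γs.condKernel t) ∂(P.map (T ∘ fy)) :=
            (lintegral_map hcs.lintegral_kernel_prod_right' hTfy).symm
        _ = ∫⁻ q, c q.swap ∂γs := by
            conv_rhs => rw [← hγs]
            rw [Measure.lintegral_compProd hcs]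
            rfl
        _ = ∫⁻ q, c q ∂γ := lintegral_map hcs measurable_swap
    rw [hcost]
    refine le_iInf₂ fun γ' hγ' ↦ ?_
    -- A competing coupling lifts to the indices and then pushes forward to the profiles.
    rw [← hpC, Measure.map_map hfd hC] at hγ'
    obtain ⟨ρ, hρ, hργ⟩ := exists_coupling_lift hγ'
    have hmT : Measurable (Prod.map id T : Fin M × Y → _) := measurable_id.prodMap hT
    refine (hopt (ρ.map (Prod.map id T)) ⟨?_, ?_⟩).trans_eq ?_
    · rw [Measure.map_map measurable_fst hmT, ← hρ.map_fst]
      rfl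
    · rw [Measure.map_map measurable_snd hmT, ← Measure.map_map hT hfy, ← hρ.map_snd,
        Measure.map_map hT measurable_snd]
      rfl
    · rw [lintegral_map hc.measurable hmT, ← hργ,
        lintegral_map (f := fun q : V × Y ↦ ℓ q.1 q.2) hℓ
          ((hfd.comp hC).prodMap measurable_id)]
      rfl

/-! ### Deterministic and quantized encoders -/

/-- Every codebook has a quantization operator: breaking ties by index makes the nearest codeword
a measurable function of the latent point. -/
lemma exists_isQuantizer {Z : Type*} [MetricSpace Z] [MeasurableSpace Z] [OpensMeasurableSpace Z]
    {M : ℕ} [NeZero M] (C : Fin M → Z) : ∃ Q, IsQuantizer C Q := by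
  obtain ⟨j, hj, hmin⟩ := exists_measurable_argmin (f := fun m z ↦ dist z (C m))
    fun m ↦ (continuous_id.dist continuous_const).measurable
  exact ⟨C ∘ j, (measurable_of_finite C).comp hj, fun z ↦ mem_range_self _, hmin⟩

/-- A quantization operator fixes the codewords. -/
lemma IsQuantizer.apply_codeword {Z : Type*} [MetricSpace Z] [MeasurableSpace Z] {M : ℕ}
    {C : Fin M → Z} {Q : Z → Z} (hQ : IsQuantizer C Q) (m : Fin M) : Q (C m) = C m := by
  have h := hQ.nearest (C m) m
  rw [dist_self] at h
  exact (dist_le_zero.1 h).symm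

lemma quantizedCosts_subset_deterministicCosts {X Z V Y : Type*} [MeasurableSpace X]
    [MetricSpace Z] [MeasurableSpace Z] {M : ℕ} (P : Measure X) (fy : X → Y) (ℓ : V → Y → ℝ≥0∞)
    (C : Fin M → Z) (π : Fin M → ℝ) (fd : Z → V) :
    quantizedCosts P fy ℓ C π fd ⊆ deterministicCosts P fy ℓ C π fd := by
  rintro _ ⟨fe, Q, hfe, hQ, hpush, rfl⟩
  exact ⟨Q ∘ fe, ⟨hQ.measurable.comp hfe, fun x ↦ hQ.codeword _, hpush⟩, rfl⟩

lemma deterministicCosts_subset_stochasticCosts {X Z V Y : Type*} [MeasurableSpace X]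
    [MeasurableSpace Z] [MeasurableSingletonClass Z] [MeasurableSpace V] [MeasurableSpace Y]
    {M : ℕ} (P : Measure X) (fy : X → Y) {ℓ : V → Y → ℝ≥0∞}
    (hℓ : Measurable (Function.uncurry ℓ)) (C : Fin M → Z) (π : Fin M → ℝ) {fd : Z → V}
    (hfd : Measurable fd) :
    deterministicCosts P fy ℓ C π fd ⊆ stochasticCosts P fy ℓ C π fd := by
  rintro _ ⟨f, hf, rfl⟩
  refine ⟨Kernel.deterministic f hf.measurable, ⟨inferInstance, fun x ↦ ?_, ?_⟩, ?_⟩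
  · rw [Kernel.deterministic_apply' _ _ (finite_range C).measurableSet.compl]
    simpa using hf.codeword x
  · rw [Measure.deterministic_comp_eq_map, hf.push]
  · refine lintegral_congr fun x ↦ ?_
    rw [Kernel.lintegral_deterministic' _ (f := fun z ↦ ℓ (fd z) (fy x))
      (hℓ.comp (hfd.prodMk measurable_const))]

/-- For a fixed codebook and decoder, encoding each data point by a codeword of smallest loss, and
taking the resulting law as weights, is at least as good as any stochastic encoder. -/
lemma exists_quantizedCosts_le {X Z V Y : Type*} [MeasurableSpace X] [MetricSpace Z]
    [MeasurableSpace Z] [OpensMeasurableSpace Z] [MeasurableSpace V] [MeasurableSpace Y] {M : ℕ}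
    [NeZero M] {P : Measure X} [IsProbabilityMeasure P] {fy : X → Y} (hfy : Measurable fy)
    {ℓ : V → Y → ℝ≥0∞} (hℓ : Measurable (Function.uncurry ℓ)) (C : Fin M → Z) (fd : Z → V) :
    ∃ π ∈ stdSimplex ℝ (Fin M), ∃ b ∈ quantizedCosts P fy ℓ C π fd,
      ∀ π', ∀ a ∈ stochasticCosts P fy ℓ C π' fd, b ≤ a := by
  have hC : Measurable C := measurable_of_finite C
  obtain ⟨j, hj, hmin⟩ := exists_measurable_argmin (f := fun m x ↦ ℓ (fd (C m)) (fy x))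
    fun m ↦ hℓ.comp (measurable_const.prodMk hfy)
  obtain ⟨Q, hQ⟩ := exists_isQuantizer C
  have : IsProbabilityMeasure (P.map j) := Measure.isProbabilityMeasure_map hj.aemeasurable
  obtain ⟨π, hπ, hπj⟩ := exists_codeMeasure_id_eq (P.map j)
  have hQC : Q ∘ (C ∘ j) = C ∘ j := funext fun x ↦ hQ.apply_codeword _
  refine ⟨π, hπ, _, ⟨C ∘ j, Q, hC.comp hj, hQ, ?_, rfl⟩, ?_⟩
  · rw [hQC, ← Measure.map_map hC hj, ← hπj, map_codeMeasure _ _ hC]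
    rfl
  · rintro π' _ ⟨κ, hκ, rfl⟩
    have := hκ.isMarkov
    refine lintegral_mono fun x ↦ ?_
    calc ℓ (fd (Q ((C ∘ j) x))) (fy x)
        = ∫⁻ _, ℓ (fd (C (j x))) (fy x) ∂κ x := by
          rw [lintegral_const, measure_univ, mul_one]
          exact congrArg (fun z ↦ ℓ (fd z) (fy x)) (hQ.apply_codeword _)
      _ ≤ ∫⁻ z, ℓ (fd z) (fy x) ∂κ x := by
          refine lintegral_mono_ae ?_
          filter_upwards [mem_ae_iff.2 (hκ.codeword x)] with z hz
          obtain ⟨m, rfl⟩ := hz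
          exact hmin x m

/-! ### Comparing optimization problems -/

lemma SameOptimum.of_forall_exists_le {A B : Set ℝ≥0∞} (hAB : A ⊆ B)
    (hBA : ∀ b ∈ B, ∃ a ∈ A, a ≤ b) : SameOptimum A B := by
  refine ⟨le_antisymm (le_sInf fun b hb ↦ ?_) (sInf_le_sInf hAB), fun v ↦ ⟨fun h ↦ ?_, fun h ↦ ?_⟩⟩
  · obtain ⟨a, ha, hab⟩ := hBA b hb
    exact (sInf_le ha).trans hab
  · refine ⟨hAB h.1, fun b hb ↦ ?_⟩
    obtain ⟨a, ha, hab⟩ := hBA b hb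
    exact (h.2 ha).trans hab
  · obtain ⟨a, ha, hav⟩ := hBA v h.1
    obtain rfl : a = v := le_antisymm hav (h.2 (hAB ha))
    exact ⟨ha, fun b hb ↦ h.2 (hAB hb)⟩

lemma SameOptimum.symm {A B : Set ℝ≥0∞} (h : SameOptimum A B) : SameOptimum B A :=
  ⟨h.1.symm, fun v ↦ (h.2 v).symm⟩

theorem mainTheorem2
    {X Z V Y : Type*} [MeasurableSpace X] [MetricSpace Z] [MeasurableSpace Z]
    [OpensMeasurableSpace Z] [MeasurableSpace V] [MeasurableSpace Y]
    (M : ℕ) (P : Measure X) [IsProbabilityMeasure P]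
    (fy : X → Y) (hfy : Measurable fy)
    (ℓ : V → Y → ℝ≥0∞) (hℓ : Measurable (Function.uncurry ℓ)) :
    (∀ (C : Fin M → Z) (π : Fin M → ℝ) (fd : Z → V),
      π ∈ stdSimplex ℝ (Fin M) → Measurable fd →
        IsLeast (stochasticCosts P fy ℓ C π fd)
          (transportCost ℓ ((codeMeasure C π).map fd) (P.map fy))) ∧
    (∀ (𝓒 : Set (Fin M → Z)) (𝓓 : Set (Z → V)), (∀ fd ∈ 𝓓, Measurable fd) →
      SameOptimum (totalCosts 𝓒 𝓓 (stochasticCosts P fy ℓ))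
        (totalCosts 𝓒 𝓓 fun C π fd =>
          {transportCost ℓ ((codeMeasure C π).map fd) (P.map fy)}) ∧
      SameOptimum (totalCosts 𝓒 𝓓 (deterministicCosts P fy ℓ))
        (totalCosts 𝓒 𝓓 (stochasticCosts P fy ℓ)) ∧
      SameOptimum (totalCosts 𝓒 𝓓 (quantizedCosts P fy ℓ))
        (totalCosts 𝓒 𝓓 (deterministicCosts P fy ℓ))) := by
  have h₁ : ∀ (C : Fin M → Z) (π : Fin M → ℝ) (fd : Z → V),
      π ∈ stdSimplex ℝ (Fin M) → Measurable fd →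
        IsLeast (stochasticCosts P fy ℓ C π fd)
          (transportCost ℓ ((codeMeasure C π).map fd) (P.map fy)) := by
    intro C π fd hπ hfd
    obtain ⟨a, ha, hle⟩ := exists_stochasticCosts_le_transportCost (P := P) hfy hℓ C hπ hfd
    obtain rfl := le_antisymm hle (transportCost_le_of_mem_stochasticCosts hfy hℓ hfd ha)
    exact ⟨ha, fun b hb ↦ transportCost_le_of_mem_stochasticCosts hfy hℓ hfd hb⟩
  refine ⟨h₁, fun 𝓒 𝓓 h𝓓 ↦ ⟨?_, ?_, ?_⟩⟩
  · refine (SameOptimum.of_forall_exists_le ?_ ?_).symm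
    · rintro _ ⟨C, hC, π, hπ, fd, hfd, rfl⟩
      exact ⟨C, hC, π, hπ, fd, hfd, (h₁ C π fd hπ (h𝓓 fd hfd)).1⟩
    · rintro a ⟨C, hC, π, hπ, fd, hfd, ha⟩
      exact ⟨_, ⟨C, hC, π, hπ, fd, hfd, rfl⟩, (h₁ C π fd hπ (h𝓓 fd hfd)).2 ha⟩
  · refine SameOptimum.of_forall_exists_le ?_ ?_
    · rintro a ⟨C, hC, π, hπ, fd, hfd, ha⟩
      exact ⟨C, hC, π, hπ, fd, hfd,
        deterministicCosts_subset_stochasticCosts P fy hℓ C π (h𝓓 fd hfd) ha⟩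
    · rintro a ⟨C, hC, π, hπ, fd, hfd, ha⟩
      have := neZero_of_mem_stdSimplex hπ
      obtain ⟨π', hπ', b, hb, hle⟩ := exists_quantizedCosts_le (P := P) hfy hℓ C fd
      exact ⟨b, ⟨C, hC, π', hπ', fd, hfd,
        quantizedCosts_subset_deterministicCosts P fy ℓ C π' fd hb⟩, hle π a ha⟩
  · refine SameOptimum.of_forall_exists_le ?_ ?_
    · rintro a ⟨C, hC, π, hπ, fd, hfd, ha⟩
      exact ⟨C, hC, π, hπ, fd, hfd, quantizedCosts_subset_deterministicCosts P fy ℓ C π fd ha⟩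
    · rintro a ⟨C, hC, π, hπ, fd, hfd, ha⟩
      have := neZero_of_mem_stdSimplex hπ
      obtain ⟨π', hπ', b, hb, hle⟩ := exists_quantizedCosts_le (P := P) hfy hℓ C fd
      exact ⟨b, ⟨C, hC, π', hπ', fd, hfd, hb⟩, hle π a
        (deterministicCosts_subset_stochasticCosts P fy hℓ C π (h𝓓 fd hfd) ha)⟩
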